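/- Consider a system of finitely many implicit-deadline sporadic self-suspending tasks $\tau_1,\dots,\tau_n$. Task $\tau_i$ has worst-case execution time $C_i\ge 0$, maximum suspension time $S_i\ge 0$ and period $T_i>0$, with $C_i+S_i\le T_i$. It releases a sequence of jobs whose consecutive release times are at least $T_i$ apart. Each job alternates in an arbitrary pattern, with finitely many phases, between computation and suspension phases, whose total lengths are at most $C_i$ and at most $S_i$, respectively; it may begin or end with a phase of either kind, and its pattern may differ from that of other jobs of the same task. The jobs of one task are processed in sequence, and a job that is released at time $r$ has its deadline at time $r+T_i$. Let $U_i=C_i/T_i$. The jobs are scheduled by preemptive global rate-monotonic (RM) scheduling on $M\ge 1$ identical processors: the tasks are indexed in order of decreasing priority, with $T_1\le T_2\le\dots\le T_n$ (ties being broken in any fixed way), and at any time the (at most) $M$ highest-priority ready jobs are executed, each on one processor. A task is called schedulable if, for all legal job releases and phase patterns, each of its jobs finishes by its deadline. Let $1\le k\le n$, and suppose that the higher-priority tasks $\tau_1,\dots,\tau_{k-1}$ are schedulable. If $$\left(\frac{C_k+S_k}{T_k}+2\right)\prod_{j=1}^{k-1}\left(\frac{U_j}{M}+1\right)\le 3,$$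 then $\tau_k$ is schedulable by global RM on $M$ processors. -/

import Mathlib

/-- An implicit-deadline sporadic self-suspending task system with `n` tasks. Task `i` has
worst-case execution time `C i`, maximum suspension time `S i` and period (minimum inter-release
time) `T i`; its relative deadline is `T i`. -/
structure SuspTaskSystem (n : ℕ) where
  C : Fin n → ℝ
  S : Fin n → ℝ
  T : Fin n → ℝ
  C_nonneg : ∀ i, 0 ≤ C i
  S_nonneg : ∀ i, 0 ≤ S i
  T_pos : ∀ i, 0 < T i
  C_add_S_le_T : ∀ i, C i + S i ≤ T i

/-- What a job does at a given point of its progress. -/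
inductive JobPhase where
  | computation
  | suspension
  | finished

open Classical in
/-- A job alternates between computation and suspension; the list `[(c₁, s₁), (c₂, s₂), …]` stands
for: compute for `c₁` time units, suspend for `s₁`, compute for `c₂`, suspend for `s₂`, and so on
(any of these lengths may be zero, so a job may also begin with a suspension or end with a
computation). `phaseAt l x` is the phase in which such a job is after `x` time units spent in
computation and suspension altogether. -/
noncomputable def phaseAt : List (ℝ × ℝ) → ℝ → JobPhase
  | [], _ => JobPhase.finished
  | (c, s) :: l, x =>
      if x < c then JobPhase.computation
      else if x < c + s then JobPhase.suspension
      else phaseAt l (x - (c + s))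

namespace SuspTaskSystem

variable {n : ℕ}

/-- The utilization of a task. -/
noncomputable def U (τ : SuspTaskSystem n) (i : Fin n) : ℝ := τ.C i / τ.T i

/-- The tasks are indexed in rate-monotonic priority order: a smaller index means a higher
priority, and priorities are given by the periods (ties may be broken in any fixed way). -/
def IsRMOrdered (τ : SuspTaskSystem n) : Prop := ∀ i j : Fin n, i ≤ j → τ.T i ≤ τ.T j

/-- The jobs that the tasks release in one run of the system. Task `i` releases the jobs
`(i, j)` with `j < numJobs i`, finitely or infinitely many. -/
structure Arrivals (τ : SuspTaskSystem n) where
  numJobs : Fin n → ℕ∞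
  release : Fin n → ℕ → ℝ
  phases : Fin n → ℕ → List (ℝ × ℝ)
  separation : ∀ (i : Fin n) (j : ℕ), ((j + 1 : ℕ) : ℕ∞) < numJobs i →
    release i j + τ.T i ≤ release i (j + 1)
  phases_nonneg : ∀ (i : Fin n) (j : ℕ), (j : ℕ∞) < numJobs i → ∀ p ∈ phases i j, 0 ≤ p.1 ∧ 0 ≤ p.2
  computation_le : ∀ (i : Fin n) (j : ℕ), (j : ℕ∞) < numJobs i →
    ((phases i j).map Prod.fst).sum ≤ τ.C i
  suspension_le : ∀ (i : Fin n) (j : ℕ), (j : ℕ∞) < numJobs i →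
    ((phases i j).map Prod.snd).sum ≤ τ.S i

/-- A schedule on `M` processors: `assign m t` is the job that processor `m` executes at time `t`
(if any), and `progress J t` is the amount of time that job `J` has spent in computation and
suspension before time `t`. -/
structure Schedule (n M : ℕ) where
  assign : Fin M → ℝ → Option (Fin n × ℕ)
  progress : Fin n × ℕ → ℝ → ℝ

variable {M : ℕ} {τ : SuspTaskSystem n}

/-- Job `J` is executed at time `t`. -/
def Schedule.Running (σ : Schedule n M) (J : Fin n × ℕ) (t : ℝ) : Prop :=
  ∃ m, σ.assign m t = some J

/-- The phase of job `J` at time `t`. -/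
noncomputable def Schedule.phase (σ : Schedule n M) (A : Arrivals τ) (J : Fin n × ℕ) (t : ℝ) :
    JobPhase :=
  phaseAt (A.phases J.1 J.2) (σ.progress J t)

/-- Job `J` has finished all its phases by time `t`. -/
def Schedule.Finished (σ : Schedule n M) (A : Arrivals τ) (J : Fin n × ℕ) (t : ℝ) : Prop :=
  σ.phase A J t = JobPhase.finished

/-- Job `J` exists, has been released, and all earlier jobs of the same task have finished
(the jobs of a task are processed in sequence). -/
def Schedule.Eligible (σ : Schedule n M) (A : Arrivals τ) (J : Fin n × ℕ) (t : ℝ) : Prop :=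
  (J.2 : ℕ∞) < A.numJobs J.1 ∧ A.release J.1 J.2 ≤ t ∧ ∀ j < J.2, σ.Finished A (J.1, j) t

/-- Job `J` is in the ready queue at time `t` (a job that is being executed counts as ready). -/
def Schedule.Ready (σ : Schedule n M) (A : Arrivals τ) (J : Fin n × ℕ) (t : ℝ) : Prop :=
  σ.Eligible A J t ∧ σ.phase A J t = JobPhase.computation

/-- Job `J` is suspended at time `t`. -/
def Schedule.Suspended (σ : Schedule n M) (A : Arrivals τ) (J : Fin n × ℕ) (t : ℝ) : Prop :=
  σ.Eligible A J t ∧ σ.phase A J t = JobPhase.suspension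

/-- `σ` is a preemptive global fixed-priority schedule of the jobs `A`, the task with the smaller
index having the higher priority. For tasks that are indexed in rate-monotonic order, this is
global RM. -/
structure Schedule.IsGlobalFP (σ : Schedule n M) (A : Arrivals τ) : Prop where
  /-- A job is never executed on two processors at the same time. -/
  no_parallel : ∀ m m' t J, σ.assign m t = some J → σ.assign m' t = some J → m = m'
  /-- At any time, exactly the `M` highest-priority ready jobs are executed (all of them, if there
  are at most `M`). -/
  dispatch : ∀ J t, σ.Running J t ↔
    σ.Ready A J t ∧ {J' : Fin n × ℕ | σ.Ready A J' t ∧ J'.1 < J.1}.encard < (M : ℕ∞)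
  measurable_running : ∀ J, MeasurableSet {t | σ.Running J t}
  /-- A job progresses at unit speed while it is executed or suspended, and not otherwise. -/
  progress_eq : ∀ J t, σ.progress J t = MeasureTheory.volume.real
    {s | s ∈ Set.Ico (A.release J.1 J.2) t ∧ (σ.Running J s ∨ σ.Suspended A J s)}

/-- Task `i` is schedulable by global RM on `M` processors (the tasks being indexed in
rate-monotonic order): whatever jobs the tasks release, every job of task `i` finishes by its
absolute deadline. -/
def SchedulableGlobalRM (τ : SuspTaskSystem n) (M : ℕ) (i : Fin n) : Prop :=
  ∀ (A : Arrivals τ) (σ : Schedule n M), σ.IsGlobalFP A →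
    ∀ j : ℕ, (j : ℕ∞) < A.numJobs i → σ.Finished A (i, j) (A.release i j + τ.T i)

end SuspTaskSystem

/-! Suppose a job of task `k`, released at `r`, misses its deadline, while all earlier jobs of the
task meet theirs. These are then finished at `r`, so at every instant from `r` to the deadline the
job runs, is suspended, or waits while `M` tasks of higher priority run. The first two states last
less than `C k + S k`. Each higher-priority task meets its deadlines, so in a window of length `x`
it runs for at most `(⌈x / T i⌉ + 1) * C i`; `M` times the waiting time is at most the sum of these
(`lt_demand_of_not_finished`). Hence `x` is below the demand for every `x` in `[0, T k]`.

It suffices to evaluate this at `T k` and at `t i`, the last multiple of `T i` up to `T k`. Since `T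
i ≤ T k`, the workload of task `i` is at most `2 * U i * t i`, plus `U i * t i` if `t i < x`
(`ceil_add_one_mul_le`). Peeling off the tasks by decreasing `t i` turns these inequalities into a
product (`add_sum_le_mul_prod`), which contradicts the hyperbolic bound (`three_lt_of_demand_gt`).
-/

open MeasureTheory

/-! ### Phase lists and the time spent in computation phases. -/

/-- The total length of all phases of a job. -/
noncomputable def phaseTotal (l : List (ℝ × ℝ)) : ℝ :=
  (l.map Prod.fst).sum + (l.map Prod.snd).sum

theorem phaseTotal_nonneg {l : List (ℝ × ℝ)} (hl : ∀ p ∈ l, 0 ≤ p.1 ∧ 0 ≤ p.2) :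
    0 ≤ phaseTotal l := by
  refine add_nonneg (List.sum_nonneg ?_) (List.sum_nonneg ?_) <;> simp only [List.mem_map] <;>
    rintro _ ⟨p, hp, rfl⟩
  exacts [(hl p hp).1, (hl p hp).2]

theorem lt_phaseTotal_of_phaseAt_ne_finished {l : List (ℝ × ℝ)}
    (hl : ∀ p ∈ l, 0 ≤ p.1 ∧ 0 ≤ p.2) {x : ℝ} (hx : phaseAt l x ≠ JobPhase.finished) :
    x < phaseTotal l := by
  induction l generalizing x with
  | nil => exact absurd rfl hx
  | cons q l ih =>
    obtain ⟨c, s⟩ := q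
    have hl' : ∀ p ∈ l, 0 ≤ p.1 ∧ 0 ≤ p.2 := fun p hp => hl p (List.mem_cons_of_mem _ hp)
    have h0 := phaseTotal_nonneg hl'
    have hcs := hl (c, s) (by simp)
    have htot : phaseTotal ((c, s) :: l) = c + s + phaseTotal l := by
      simp only [phaseTotal, List.map_cons, List.sum_cons]; ring
    rw [htot]
    by_cases h1 : x < c + s
    · linarith
    · have h2 : ¬ x < c := fun h => h1 (by linarith [hcs.2])
      rw [phaseAt, if_neg h2, if_neg h1] at hx
      linarith [ih hl' hx]

theorem phaseAt_finished_mono {l : List (ℝ × ℝ)} {x y : ℝ} (hxy : x ≤ y)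
    (hx : phaseAt l x = JobPhase.finished) : phaseAt l y = JobPhase.finished := by
  induction l generalizing x y with
  | nil => rfl
  | cons q l ih =>
    obtain ⟨c, s⟩ := q
    by_cases h2 : x < c
    · simp [phaseAt, h2] at hx
    by_cases h1 : x < c + s
    · simp [phaseAt, h2, h1] at hx
    rw [phaseAt, if_neg h2, if_neg h1] at hx
    rw [phaseAt, if_neg (fun h => h2 (by linarith)), if_neg (fun h => h1 (by linarith))]
    exact ih (by linarith) hx

theorem measurableSet_phaseAt_eq (l : List (ℝ × ℝ)) (q : JobPhase) {g : ℝ → ℝ}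
    (hg : Measurable g) : MeasurableSet {t | phaseAt l (g t) = q} := by
  induction l generalizing g with
  | nil => exact MeasurableSet.const (JobPhase.finished = q)
  | cons p l ih =>
    obtain ⟨c, s⟩ := p
    have h : {t | phaseAt ((c, s) :: l) (g t) = q} =
        ({t | g t < c} ∩ {_t | JobPhase.computation = q}) ∪
        (({t | g t < c}ᶜ ∩ {t | g t < c + s}) ∩ {_t | JobPhase.suspension = q}) ∪
        (({t | g t < c}ᶜ ∩ {t | g t < c + s}ᶜ) ∩ {t | phaseAt l (g t - (c + s)) = q}) := by
      ext t
      by_cases h1 : g t < c <;> by_cases h2 : g t < c + s <;> simp [phaseAt, h1, h2]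
    rw [h]
    have m1 : MeasurableSet {t | g t < c} := measurableSet_lt hg measurable_const
    have m2 : MeasurableSet {t | g t < c + s} := measurableSet_lt hg measurable_const
    exact ((m1.inter (.const _)).union ((m1.compl.inter m2).inter (.const _))).union
      ((m1.compl.inter m2.compl).inter (ih (hg.sub_const _)))

/-- If `p` grows at least as fast as time passes in `E`, then `p` takes values in an interval of
length `b - a` for at most that long within `E`. -/
theorem volume_inter_preimage_Ico_le {E : Set ℝ} (hE : MeasurableSet E) {p : ℝ → ℝ}
    (hp : Monotone p)
    (hpE : ∀ x y, x ≤ y → volume (E ∩ Set.Ico x y) ≤ ENNReal.ofReal (p y - p x)) (a b : ℝ) :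
    volume (E ∩ p ⁻¹' Set.Ico a b) ≤ ENNReal.ofReal (b - a) := by
  have hm : MeasurableSet (E ∩ p ⁻¹' Set.Ico a b) := hE.inter (hp.measurable measurableSet_Ico)
  -- A compact subset attains its least and greatest points, where `p` takes values in `[a, b)`; so
  -- continuity of `p` is not needed.
  rw [hm.measure_eq_iSup_isCompact]
  refine iSup_le fun K => iSup_le fun hK => iSup_le fun hc => ?_
  rcases K.eq_empty_or_nonempty with rfl | hne
  · simp
  obtain ⟨x, hx⟩ := hc.exists_isLeast hne
  obtain ⟨y, hy⟩ := hc.exists_isGreatest hne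
  have hsub : K ⊆ (E ∩ Set.Ico x y) ∪ {y} := fun z hz => by
    rcases (hy.2 hz).lt_or_eq with h | h
    · exact Or.inl ⟨(hK hz).1, hx.2 hz, h⟩
    · exact Or.inr h
  calc volume K ≤ volume (E ∩ Set.Ico x y) + volume {y} :=
        (measure_mono hsub).trans (measure_union_le _ _)
    _ = volume (E ∩ Set.Ico x y) := by simp
    _ ≤ ENNReal.ofReal (p y - p x) := hpE x y (hx.2 hy.1)
    _ ≤ _ := ENNReal.ofReal_le_ofReal (by
        have h1 := (hK hx.1).2.1
        have h2 := (hK hy.1).2.2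
        linarith)

/-- Each computation phase occupies an interval of progress values as long as the phase. The offset
`a` is the progress used up by the phases already peeled off. -/
theorem volume_inter_computation_le {E : Set ℝ} (hE : MeasurableSet E) {p : ℝ → ℝ}
    (hp : Monotone p)
    (hpE : ∀ x y, x ≤ y → volume (E ∩ Set.Ico x y) ≤ ENNReal.ofReal (p y - p x))
    {l : List (ℝ × ℝ)} (hl : ∀ q ∈ l, 0 ≤ q.1 ∧ 0 ≤ q.2) (a : ℝ) :
    volume (E ∩ {s | a ≤ p s ∧ phaseAt l (p s - a) = JobPhase.computation}) ≤
      ENNReal.ofReal (l.map Prod.fst).sum := by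
  induction l generalizing a with
  | nil => simp [phaseAt]
  | cons q l ih =>
    obtain ⟨c, d⟩ := q
    have hl' : ∀ p ∈ l, 0 ≤ p.1 ∧ 0 ≤ p.2 := fun p hp => hl p (List.mem_cons_of_mem _ hp)
    have hcd := hl (c, d) (by simp)
    have hsub : E ∩ {s | a ≤ p s ∧ phaseAt ((c, d) :: l) (p s - a) = JobPhase.computation} ⊆
        (E ∩ p ⁻¹' Set.Ico a (a + c)) ∪ (E ∩ {s | a + (c + d) ≤ p s ∧
          phaseAt l (p s - (a + (c + d))) = JobPhase.computation}) := by
      rintro s ⟨hsE, has, hs⟩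
      by_cases h1 : p s - a < c
      · exact Or.inl ⟨hsE, has, by linarith⟩
      by_cases h2 : p s - a < c + d
      · simp [phaseAt, h1, h2] at hs
      rw [phaseAt, if_neg h1, if_neg h2, sub_sub] at hs
      exact Or.inr ⟨hsE, by linarith, hs⟩
    calc _ ≤ _ := (measure_mono hsub).trans (measure_union_le _ _)
      _ ≤ ENNReal.ofReal (a + c - a) + ENNReal.ofReal (l.map Prod.fst).sum :=
        add_le_add (volume_inter_preimage_Ico_le hE hp hpE _ _) (ih hl' _)
      _ = _ := by
        rw [add_sub_cancel_left, ← ENNReal.ofReal_add hcd.1, List.map_cons, List.sum_cons]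
        exact List.sum_nonneg (by
          simp only [List.mem_map]; rintro _ ⟨p, hp, rfl⟩; exact (hl' p hp).1)

/-! ### From demand inequalities to the hyperbolic bound. -/

/-- The combinatorial core of the utilization bound, for tasks sorted by `t`. -/
theorem add_sum_le_mul_prod {ι : Type*} [DecidableEq ι] (s : Finset ι) (u t : ι → ℝ)
    (hu : ∀ i ∈ s, 0 ≤ u i) (ht : ∀ i ∈ s, 0 ≤ t i) (A : ℝ)
    (h : ∀ j ∈ s, t j ≤ A + ∑ i ∈ s with t i < t j, u i * t i) :
    A + ∑ i ∈ s, u i * t i ≤ A * ∏ i ∈ s, (u i + 1) := by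
  induction s using Finset.induction_on_max_value t with
  | empty => simp
  | insert a s ha hmax ih =>
    have hu' := fun i hi => hu i (Finset.mem_insert_of_mem hi)
    have ht' := fun i hi => ht i (Finset.mem_insert_of_mem hi)
    -- The strict filter drops the maximal element `a` from every earlier condition, ties included.
    have ih' := ih hu' ht' fun j hj => by
      have := h j (Finset.mem_insert_of_mem hj)
      rwa [Finset.filter_insert, if_neg (not_lt.2 (hmax j hj))] at this
    have h1 : t a ≤ A + ∑ i ∈ s, u i * t i := by
      have := h a (Finset.mem_insert_self _ _)
      rw [Finset.filter_insert, if_neg (lt_irrefl _)] at this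
      exact this.trans (add_le_add le_rfl (Finset.sum_le_sum_of_subset_of_nonneg
        (Finset.filter_subset _ _) fun i hi _ => mul_nonneg (hu' i hi) (ht' i hi)))
    have h2 := hu a (Finset.mem_insert_self _ _)
    rw [Finset.sum_insert ha, Finset.prod_insert ha]
    calc A + (u a * t a + ∑ i ∈ s, u i * t i)
        ≤ A + (u a * (A + ∑ i ∈ s, u i * t i) + ∑ i ∈ s, u i * t i) := by gcongr
      _ = (u a + 1) * (A + ∑ i ∈ s, u i * t i) := by ring
      _ ≤ (u a + 1) * (A * ∏ i ∈ s, (u i + 1)) := by gcongr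
      _ = _ := by ring

/-- The `k`-point effective schedulability test: if the test points `t i` and `D` all violate
their demand bound, then the hyperbolic utilization bound is violated. -/
theorem three_lt_of_demand_gt {ι : Type*} [DecidableEq ι] (s : Finset ι) (u t : ι → ℝ)
    (hu : ∀ i ∈ s, 0 ≤ u i) (ht : ∀ i ∈ s, 0 ≤ t i) {X D : ℝ} (hX : 0 < X) (hD : 0 < D)
    (h : ∀ x, (x = D ∨ ∃ j ∈ s, x = t j) →
      x < X + 2 * ∑ i ∈ s, u i * t i + ∑ i ∈ s with t i < x, u i * t i) :
    3 < (X / D + 2) * ∏ i ∈ s, (u i + 1) := by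
  have key := add_sum_le_mul_prod s u t hu ht (X + 2 * ∑ i ∈ s, u i * t i)
    fun j hj => (h (t j) (Or.inr ⟨j, hj, rfl⟩)).le
  have hDlt := (h D (Or.inl rfl)).trans_le (add_le_add le_rfl (Finset.sum_le_sum_of_subset_of_nonneg
        (Finset.filter_subset _ _) fun i hi _ => mul_nonneg (hu i hi) (ht i hi)))
  have hP : 1 ≤ ∏ i ∈ s, (u i + 1) :=
    Finset.one_le_prod fun i hi => by linarith [hu i hi]
  have hW : 0 ≤ ∑ i ∈ s, u i * t i := Finset.sum_nonneg fun i hi => mul_nonneg (hu i hi) (ht i hi)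
  generalize ∏ i ∈ s, (u i + 1) = P at *
  generalize ∑ i ∈ s, u i * t i = W at *
  -- The negation gives `X * P ≤ D * (3 - 2 * P)`, hence `3 - 2 * P > 0`. By `key`, `W * (3 - 2 * P)
  -- ≤ X * (P - 1)`, so multiplying `D < X + 3 * W` by `3 - 2 * P` yields `D * (3 - 2 * P) < X * P`.
  by_contra! hc
  have hc' : (X + 2 * D) * P ≤ 3 * D := by
    have : (X / D + 2) * P * D = (X + 2 * D) * P := by field_simp
    nlinarith
  have hXP : 0 < X * P := by positivity
  have h3 : 0 < 3 - 2 * P := by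
    by_contra! hn
    nlinarith
  nlinarith [mul_lt_mul_of_pos_right hDlt h3]

/-! ### Progress and workload in a schedule. -/

namespace SuspTaskSystem

variable {n M : ℕ} {τ : SuspTaskSystem n} {A : Arrivals τ} {σ : Schedule n M}

theorem Arrivals.phaseTotal_le {i : Fin n} {j : ℕ} (hj : (j : ℕ∞) < A.numJobs i) :
    phaseTotal (A.phases i j) ≤ τ.C i + τ.S i :=
  add_le_add (A.computation_le i j hj) (A.suspension_le i j hj)

theorem Arrivals.release_add_mul_le {i : Fin n} {j m : ℕ}
    (hj : ((j + m : ℕ) : ℕ∞) < A.numJobs i) :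
    A.release i j + m * τ.T i ≤ A.release i (j + m) := by
  induction m with
  | zero => simp
  | succ m ih =>
    have h1 := A.separation i (j + m) (by simpa [add_assoc] using hj)
    have h2 := ih (lt_of_le_of_lt (by gcongr; omega) hj)
    push_cast
    rw [← add_assoc j m 1]
    linarith

theorem Arrivals.release_add_period_le {i : Fin n} {j j' : ℕ} (hjj : j < j')
    (hj : (j' : ℕ∞) < A.numJobs i) : A.release i j + τ.T i ≤ A.release i j' := by
  obtain ⟨m, rfl⟩ := Nat.exists_eq_add_of_lt hjj
  have h := A.release_add_mul_le (i := i) (j := j) (m := m + 1) (by simpa [add_assoc] using hj)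
  have h0 : 0 ≤ (m : ℝ) * τ.T i := mul_nonneg (Nat.cast_nonneg _) (τ.T_pos i).le
  rw [add_assoc]
  push_cast at h
  linarith

/-- The times at which job `J` makes progress. -/
def Schedule.activeSet (σ : Schedule n M) (A : Arrivals τ) (J : Fin n × ℕ) : Set ℝ :=
  {s | σ.Running J s ∨ σ.Suspended A J s}

namespace Schedule.IsGlobalFP

theorem ready_of_running (h : σ.IsGlobalFP A) {J : Fin n × ℕ} {t : ℝ} (hr : σ.Running J t) :
    σ.Ready A J t :=
  ((h.dispatch J t).1 hr).1

theorem progress_eq_activeSet (h : σ.IsGlobalFP A) (J : Fin n × ℕ) (t : ℝ) :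
    σ.progress J t = volume.real (σ.activeSet A J ∩ Set.Ico (A.release J.1 J.2) t) := by
  rw [h.progress_eq, Set.inter_comm]; rfl

theorem volume_Ico_inter_ne_top (B : Set ℝ) (x y : ℝ) : volume (B ∩ Set.Ico x y) ≠ ⊤ :=
  ne_top_of_le_ne_top (by simp) (measure_mono (t := Set.Ico x y) Set.inter_subset_right)

theorem progress_mono (h : σ.IsGlobalFP A) (J : Fin n × ℕ) : Monotone (σ.progress J) := by
  intro x y hxy
  simp only [h.progress_eq_activeSet]
  exact measureReal_mono (Set.inter_subset_inter_right _ (Set.Ico_subset_Ico_right hxy))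
    (volume_Ico_inter_ne_top _ _ _)

theorem progress_nonneg (h : σ.IsGlobalFP A) (J : Fin n × ℕ) (t : ℝ) : 0 ≤ σ.progress J t := by
  rw [h.progress_eq_activeSet]; exact measureReal_nonneg

theorem finished_mono (h : σ.IsGlobalFP A) {J : Fin n × ℕ} {s t : ℝ} (hst : s ≤ t)
    (hf : σ.Finished A J s) : σ.Finished A J t :=
  phaseAt_finished_mono (h.progress_mono J hst) hf

theorem measurableSet_phase_eq (h : σ.IsGlobalFP A) (J : Fin n × ℕ) (q : JobPhase) :
    MeasurableSet {t | σ.phase A J t = q} :=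
  measurableSet_phaseAt_eq _ q (h.progress_mono J).measurable

theorem measurableSet_suspended (h : σ.IsGlobalFP A) (J : Fin n × ℕ) :
    MeasurableSet {t | σ.Suspended A J t} := by
  have : {t | σ.Suspended A J t} = (({_t | (J.2 : ℕ∞) < A.numJobs J.1} ∩
      Set.Ici (A.release J.1 J.2)) ∩ ⋂ j ∈ Set.Iio J.2, {t | σ.phase A (J.1, j) t =
        JobPhase.finished}) ∩ {t | σ.phase A J t = JobPhase.suspension} := by
    ext t
    simp [Schedule.Suspended, Schedule.Eligible, Schedule.Finished, and_assoc]
  rw [this]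
  exact (((MeasurableSet.const _).inter measurableSet_Ici).inter
    (MeasurableSet.biInter (Set.to_countable _) fun j _ => h.measurableSet_phase_eq _ _)).inter
    (h.measurableSet_phase_eq _ _)

theorem measurableSet_activeSet (h : σ.IsGlobalFP A) (J : Fin n × ℕ) :
    MeasurableSet (σ.activeSet A J) :=
  (h.measurable_running J).union (h.measurableSet_suspended J)

theorem release_le_of_mem_activeSet (h : σ.IsGlobalFP A) {J : Fin n × ℕ} {t : ℝ}
    (ht : t ∈ σ.activeSet A J) : A.release J.1 J.2 ≤ t :=
  ht.elim (fun hr => (h.ready_of_running hr).1.2.1) fun hs => hs.1.2.1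

/-- Nothing is active before its release, so `x` may precede the release although progress is
counted only from there. -/
theorem volume_activeSet_inter_Ico_le (h : σ.IsGlobalFP A) (J : Fin n × ℕ) {x y : ℝ}
    (hxy : x ≤ y) : volume (σ.activeSet A J ∩ Set.Ico x y) ≤
      ENNReal.ofReal (σ.progress J y - σ.progress J x) := by
  set r := A.release J.1 J.2
  have hdisj : Disjoint (σ.activeSet A J ∩ Set.Ico r x) (σ.activeSet A J ∩ Set.Ico x y) :=
    Set.disjoint_left.2 fun s hs hs' => not_lt.2 hs'.2.1 hs.2.2
  have hsub : (σ.activeSet A J ∩ Set.Ico r x) ∪ (σ.activeSet A J ∩ Set.Ico x y) ⊆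
      σ.activeSet A J ∩ Set.Ico r y := by
    rintro s (hs | hs)
    · exact ⟨hs.1, hs.2.1, hs.2.2.trans_le hxy⟩
    · exact ⟨hs.1, h.release_le_of_mem_activeSet hs.1, hs.2.2⟩
  have hle := measureReal_mono hsub (volume_Ico_inter_ne_top _ _ _)
  rw [measureReal_union hdisj ((h.measurableSet_activeSet J).inter measurableSet_Ico)
    (volume_Ico_inter_ne_top _ _ _) (volume_Ico_inter_ne_top _ _ _),
    ← h.progress_eq_activeSet, ← h.progress_eq_activeSet] at hle
  rw [← ENNReal.ofReal_toReal (volume_Ico_inter_ne_top (σ.activeSet A J) x y)]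
  refine ENNReal.ofReal_le_ofReal ?_
  rw [← measureReal_def]
  linarith

/-- A job is executed for at most its worst-case execution time. -/
theorem volume_running_le (h : σ.IsGlobalFP A) {i : Fin n} {j : ℕ}
    (hj : (j : ℕ∞) < A.numJobs i) :
    volume {s | σ.Running (i, j) s} ≤ ENNReal.ofReal (τ.C i) := by
  calc volume {s | σ.Running (i, j) s}
      ≤ volume (σ.activeSet A (i, j) ∩ {s | 0 ≤ σ.progress (i, j) s ∧
          phaseAt (A.phases i j) (σ.progress (i, j) s - 0) = JobPhase.computation}) :=
        measure_mono fun s hs => ⟨Or.inl hs, h.progress_nonneg _ _, by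
          rw [sub_zero]; exact (h.ready_of_running hs).2⟩
    _ ≤ ENNReal.ofReal ((A.phases i j).map Prod.fst).sum :=
        volume_inter_computation_le (h.measurableSet_activeSet _) (h.progress_mono _)
          (fun x y hxy => h.volume_activeSet_inter_Ico_le _ hxy) (A.phases_nonneg i j hj) 0
    _ ≤ _ := ENNReal.ofReal_le_ofReal (A.computation_le i j hj)

/-- The times at which some job of task `i` is executed. -/
def _root_.SuspTaskSystem.Schedule.busySet (σ : Schedule n M) (i : Fin n) : Set ℝ :=
  {s | ∃ j, σ.Running (i, j) s}

theorem measurableSet_busySet (h : σ.IsGlobalFP A) (i : Fin n) : MeasurableSet (σ.busySet i) := by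
  rw [Schedule.busySet, Set.ofPred_exists]
  exact MeasurableSet.iUnion fun j => h.measurable_running _

/-- The workload of a task that meets its deadlines, in a window of length `x`. -/
theorem volume_busySet_inter_Ico_le (h : σ.IsGlobalFP A) {i : Fin n}
    (hi : ∀ j : ℕ, (j : ℕ∞) < A.numJobs i → σ.Finished A (i, j) (A.release i j + τ.T i))
    (r x : ℝ) : volume (σ.busySet i ∩ Set.Ico r (r + x)) ≤
      ENNReal.ofReal (((⌈x / τ.T i⌉₊ : ℝ) + 1) * τ.C i) := by
  classical
  have hT := τ.T_pos i
  have hrun : ∀ j s, s ∈ Set.Ico r (r + x) → σ.Running (i, j) s →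
      (j : ℕ∞) < A.numJobs i ∧ r - τ.T i < A.release i j ∧ A.release i j < r + x := by
    intro j s hs hj
    have hrd := h.ready_of_running hj
    refine ⟨hrd.1.1, ?_, hrd.1.2.1.trans_lt hs.2⟩
    by_contra! hle
    have hfin := h.finished_mono (s := A.release i j + τ.T i) (t := s)
      (by linarith [hs.1]) (hi j hrd.1.1)
    have := hrd.2
    rw [Schedule.Finished] at hfin
    rw [hfin] at this
    cases this
  by_cases hex : ∃ j s, s ∈ Set.Ico r (r + x) ∧ σ.Running (i, j) s
  · set j₀ := Nat.find hex
    obtain ⟨s₀, hs₀, hj₀⟩ := Nat.find_spec hex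
    have h₀ := hrun _ s₀ hs₀ hj₀
    -- The relevant releases lie in the open interval from `r - T i` to `r + x`, of length `x + T
    -- i`, and are `T i` apart.
    set N := ⌈x / τ.T i⌉₊ + 1
    have hsub : σ.busySet i ∩ Set.Ico r (r + x) ⊆
        ⋃ j ∈ (Finset.Ico j₀ (j₀ + N)).filter fun j : ℕ => (j : ℕ∞) < A.numJobs i,
          {s | σ.Running (i, j) s} := by
      rintro s ⟨⟨j, hj⟩, hs⟩
      obtain ⟨hn, hlo, hup⟩ := hrun j s hs hj
      have hmin : j₀ ≤ j := Nat.find_min' hex ⟨s, hs, hj⟩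
      simp only [Set.mem_iUnion, Finset.mem_filter, Finset.mem_Ico]
      refine ⟨j, ⟨⟨hmin, ?_⟩, hn⟩, hj⟩
      obtain ⟨m, hm⟩ := Nat.exists_eq_add_of_le hmin
      rw [hm] at hup hn ⊢
      have hsep := A.release_add_mul_le hn
      have h1 : (m : ℝ) * τ.T i < x + τ.T i := by linarith [h₀.2.1]
      have h2 : (m : ℝ) < x / τ.T i + 1 := by
        rw [div_add_one hT.ne', lt_div_iff₀ hT]; exact h1
      have h3 : (m : ℝ) < (N : ℕ) := by
        simp only [N]; push_cast; linarith [Nat.le_ceil (x / τ.T i)]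
      have h4 : m < N := by exact_mod_cast h3
      omega
    refine (measure_mono hsub).trans ((measure_biUnion_finset_le _ _).trans ?_)
    calc _ ≤ ∑ j ∈ (Finset.Ico j₀ (j₀ + N)).filter fun j : ℕ => (j : ℕ∞) < A.numJobs i,
          ENNReal.ofReal (τ.C i) :=
        Finset.sum_le_sum fun j hj => h.volume_running_le (Finset.mem_filter.1 hj).2
      _ ≤ ∑ j ∈ Finset.Ico j₀ (j₀ + N), ENNReal.ofReal (τ.C i) :=
        Finset.sum_le_sum_of_subset (Finset.filter_subset _ _)
      _ = _ := by
        rw [Finset.sum_const, Nat.card_Ico, add_tsub_cancel_left, nsmul_eq_mul,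
          ENNReal.ofReal_mul (by positivity), ← Nat.cast_add_one, ENNReal.ofReal_natCast]
  · have : σ.busySet i ∩ Set.Ico r (r + x) = ∅ :=
      Set.eq_empty_of_forall_notMem fun s hs => hex ⟨hs.1.choose, s, hs.2, hs.1.choose_spec⟩
    simp [this]

end Schedule.IsGlobalFP
end SuspTaskSystem

/-! ### Interference under global dispatching. -/

/-- If at least `M` elements of a finite linearly ordered set are given, then at least `M` of them
have fewer than `M` predecessors. -/
theorem Finset.le_card_filter_card_lt {α : Type*} [LinearOrder α] (R : Finset α) {M : ℕ}
    (hM : M ≤ R.card) : M ≤ (R.filter fun i => (R.filter (· < i)).card < M).card := by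
  set Q := R.filter fun i => (R.filter (· < i)).card < M with hQ
  by_contra! hlt
  have hne : (R \ Q).Nonempty := by
    rw [Finset.sdiff_nonempty]
    exact fun hsub => absurd (Finset.card_le_card hsub) (by omega)
  -- All predecessors of a minimal `x` outside `Q` lie in `Q`, which has fewer than `M` elements, so
  -- `x` belongs to `Q` after all.
  obtain ⟨x, hx⟩ := (R \ Q).exists_minimal hne
  have hxR := Finset.mem_sdiff.1 hx.1
  refine hxR.2 (Finset.mem_filter.2 ⟨hxR.1, lt_of_le_of_lt (Finset.card_le_card ?_) hlt⟩)
  intro i hi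
  obtain ⟨hiR, hix⟩ := Finset.mem_filter.1 hi
  by_contra hiQ
  exact not_le.2 hix (hx.2 (Finset.mem_sdiff.2 ⟨hiR, hiQ⟩) hix.le)

namespace SuspTaskSystem

variable {n M : ℕ} {τ : SuspTaskSystem n} {A : Arrivals τ} {σ : Schedule n M}

theorem Schedule.Ready.index_eq {i : Fin n} {j j' : ℕ} {s : ℝ} (hj : σ.Ready A (i, j) s)
    (hj' : σ.Ready A (i, j') s) : j = j' := by
  have key : ∀ {a b : ℕ}, σ.Ready A (i, a) s → σ.Ready A (i, b) s → ¬ a < b := by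
    intro a b ha hb hab
    have hf : σ.phase A (i, a) s = JobPhase.finished := hb.1.2.2 a hab
    rw [ha.2] at hf
    cases hf
  exact le_antisymm (not_lt.1 (key hj' hj)) (not_lt.1 (key hj hj'))

-- Sequential processing leaves at most one ready job per task, so ready jobs can be counted as
-- tasks.
open Classical in
theorem Schedule.encard_ready_lt (σ : Schedule n M) (A : Arrivals τ) (i : Fin n) (s : ℝ) :
    {J' : Fin n × ℕ | σ.Ready A J' s ∧ J'.1 < i}.encard =
      ((Finset.univ.filter fun i' => i' < i ∧ ∃ j, σ.Ready A (i', j) s).card : ℕ∞) := by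
  have hinj : Set.InjOn Prod.fst {J' : Fin n × ℕ | σ.Ready A J' s ∧ J'.1 < i} := by
    rintro ⟨a, b⟩ h1 ⟨c, d⟩ h2 (rfl : a = c)
    rw [h1.1.index_eq h2.1]
  rw [← hinj.encard_image, ← Set.encard_coe_eq_coe_finsetCard]
  congr 1
  ext i'
  simp [and_comm]

namespace Schedule.IsGlobalFP

open Classical in
/-- While a ready job waits, at least `M` tasks of higher priority are executed. -/
theorem le_card_busySet (h : σ.IsGlobalFP A) {J : Fin n × ℕ} {s : ℝ} (hr : σ.Ready A J s)
    (hn : ¬ σ.Running J s) :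
    M ≤ ((Finset.Iio J.1).filter fun i => s ∈ σ.busySet i).card := by
  set R := Finset.univ.filter fun i' => i' < J.1 ∧ ∃ j, σ.Ready A (i', j) s
  have hR : M ≤ R.card := by
    by_contra! hlt
    refine hn ((h.dispatch J s).2 ⟨hr, ?_⟩)
    rw [σ.encard_ready_lt]
    exact_mod_cast hlt
  refine (R.le_card_filter_card_lt hR).trans (Finset.card_le_card fun i hi => ?_)
  obtain ⟨hiR, hcard⟩ := Finset.mem_filter.1 hi
  obtain ⟨-, hik, j, hj⟩ := Finset.mem_filter.1 hiR
  refine Finset.mem_filter.2 ⟨Finset.mem_Iio.2 hik, j, (h.dispatch _ _).2 ⟨hj, ?_⟩⟩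
  rw [σ.encard_ready_lt]
  refine lt_of_le_of_lt (Nat.cast_le.2 (Finset.card_le_card fun i' hi' => ?_))
    (Nat.cast_lt.2 hcard)
  obtain ⟨-, hlt, hex⟩ := Finset.mem_filter.1 hi'
  exact Finset.mem_filter.2 ⟨Finset.mem_filter.2 ⟨Finset.mem_univ _, hlt.trans hik, hex⟩, hlt⟩

/-- The time for which a ready job waits is bounded by the workload of higher priority. -/
theorem mul_volume_waiting_le (h : σ.IsGlobalFP A) (J : Fin n × ℕ) (x y : ℝ) :
    (M : ENNReal) * volume ({s | σ.Ready A J s ∧ ¬ σ.Running J s} ∩ Set.Ico x y) ≤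
      ∑ i ∈ Finset.Iio J.1, volume (σ.busySet i ∩ Set.Ico x y) := by
  classical
  have hm : ∀ i, MeasurableSet (σ.busySet i ∩ Set.Ico x y) := fun i =>
    (h.measurableSet_busySet i).inter measurableSet_Ico
  set f : ℝ → ENNReal := fun s => ∑ i ∈ Finset.Iio J.1,
    (σ.busySet i ∩ Set.Ico x y).indicator 1 s
  have hf : Measurable f := Finset.measurable_fun_sum _ fun i _ => measurable_one.indicator (hm i)
  -- Markov's inequality for `f`, the number of higher-priority tasks running.
  calc _ ≤ (M : ENNReal) * volume {s | (M : ENNReal) ≤ f s} := by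
        gcongr
        rintro s ⟨⟨hr, hn⟩, hs⟩
        have : f s = ((Finset.Iio J.1).filter fun i => s ∈ σ.busySet i).card := by
          simp [f, Set.indicator_apply, hs.1, hs.2, Finset.sum_boole]
        rw [Set.mem_ofPred_eq, this]
        exact_mod_cast h.le_card_busySet hr hn
    _ ≤ ∫⁻ s, f s := mul_meas_ge_le_lintegral hf _
    _ = _ := by
        rw [lintegral_finsetSum _ fun i _ => measurable_one.indicator (hm i)]
        exact Finset.sum_congr rfl fun i _ => lintegral_indicator_one (hm i)

/-- The demand bound: as long as a job whose predecessors have finished is unfinished, the time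
elapsed since its release is less than its own demand and the interference together. -/
theorem lt_demand_of_not_finished (h : σ.IsGlobalFP A) (hM : 0 < M) {k : Fin n} {j : ℕ}
    (hj : (j : ℕ∞) < A.numJobs k)
    (hhp : ∀ i < k, ∀ j : ℕ, (j : ℕ∞) < A.numJobs i →
      σ.Finished A (i, j) (A.release i j + τ.T i))
    (hprev : ∀ j' < j, σ.Finished A (k, j') (A.release k j)) {x : ℝ} (hx : 0 ≤ x)
    (hnf : ¬ σ.Finished A (k, j) (A.release k j + x)) :
    x < τ.C k + τ.S k + (∑ i ∈ Finset.Iio k, ((⌈x / τ.T i⌉₊ : ℝ) + 1) * τ.C i) / M := by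
  set r := A.release k j
  set W := {s | σ.Ready A (k, j) s ∧ ¬ σ.Running (k, j) s} ∩ Set.Ico r (r + x)
  set I := ∑ i ∈ Finset.Iio k, ((⌈x / τ.T i⌉₊ : ℝ) + 1) * τ.C i
  have hprog : σ.progress (k, j) (r + x) < τ.C k + τ.S k :=
    (lt_phaseTotal_of_phaseAt_ne_finished (A.phases_nonneg k j hj) hnf).trans_le
      (A.phaseTotal_le hj)
  have hterm : ∀ i ∈ Finset.Iio k, 0 ≤ ((⌈x / τ.T i⌉₊ : ℝ) + 1) * τ.C i := fun i _ =>
    mul_nonneg (by positivity) (τ.C_nonneg i)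
  have hcover : Set.Ico r (r + x) ⊆ (σ.activeSet A (k, j) ∩ Set.Ico r (r + x)) ∪ W := by
    intro s hs
    have hel : σ.Eligible A (k, j) s :=
      ⟨hj, hs.1, fun j' hj' => h.finished_mono hs.1 (hprev j' hj')⟩
    have hns : ¬ σ.Finished A (k, j) s := fun hf => hnf (h.finished_mono hs.2.le hf)
    by_cases hrun : σ.Running (k, j) s
    · exact Or.inl ⟨Or.inl hrun, hs⟩
    · rcases hph : σ.phase A (k, j) s with _ | _ | _
      · exact Or.inr ⟨⟨⟨hel, hph⟩, hrun⟩, hs⟩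
      · exact Or.inl ⟨Or.inr ⟨hel, hph⟩, hs⟩
      · exact absurd hph hns
  have hWtop : volume W ≠ ⊤ := volume_Ico_inter_ne_top _ _ _
  have hx' : x ≤ σ.progress (k, j) (r + x) + volume.real W := by
    rw [h.progress_eq_activeSet]
    calc x = volume.real (Set.Ico r (r + x)) := by
          rw [Real.volume_real_Ico_of_le (by linarith)]; ring
      _ ≤ _ := measureReal_mono hcover
          (measure_union_ne_top (volume_Ico_inter_ne_top _ _ _) hWtop)
      _ ≤ _ := measureReal_union_le _ _
  have hW : M * volume.real W ≤ I := by
    have h1 : (M : ENNReal) * volume W ≤ ENNReal.ofReal I := by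
      rw [ENNReal.ofReal_sum_of_nonneg hterm]
      exact (h.mul_volume_waiting_le (k, j) r (r + x)).trans (Finset.sum_le_sum fun i hi =>
        h.volume_busySet_inter_Ico_le (hhp i (Finset.mem_Iio.1 hi)) r x)
    have h2 := ENNReal.toReal_mono ENNReal.ofReal_ne_top h1
    rwa [ENNReal.toReal_mul, ENNReal.toReal_natCast,
      ENNReal.toReal_ofReal (Finset.sum_nonneg hterm)] at h2
  have hW' : volume.real W ≤ I / M := by
    rw [le_div_iff₀ (by exact_mod_cast hM)]; linarith
  linarith

end Schedule.IsGlobalFP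

/-! ### Test points and the final contradiction. -/

/-- The number of jobs of a task of period `T` in a window of length `x ≤ D`, in terms of the last
multiple of `T` up to `D`. -/
theorem ceil_add_one_mul_le {C T D x : ℝ} (hC : 0 ≤ C) (hT : 0 < T) (hTD : T ≤ D) (hxD : x ≤ D) :
    ((⌈x / T⌉₊ : ℝ) + 1) * C ≤ 2 * (C / T * (⌊D / T⌋₊ * T)) +
      if ⌊D / T⌋₊ * T < x then C / T * (⌊D / T⌋₊ * T) else 0 := by
  -- With `m = ⌊D / T⌋₊ ≥ 1`, the job counts `m + 1` and `m + 2` are at most `2 * m` and `3 * m`;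
  -- this is where the constants 2 and 3 come from.
  have hm1 : (1 : ℝ) ≤ ⌊D / T⌋₊ := by
    exact_mod_cast (Nat.one_le_floor_iff _).2 ((one_le_div hT).2 hTD)
  have hCT : C / T * (⌊D / T⌋₊ * T) = ⌊D / T⌋₊ * C := by field_simp
  rw [hCT]
  split_ifs with hlt
  · have hc : ⌈x / T⌉₊ ≤ ⌊D / T⌋₊ + 1 := by
      rw [Nat.ceil_le]
      push_cast
      exact ((div_le_div_iff_of_pos_right hT).2 hxD).trans (Nat.lt_floor_add_one _).le
    have hc' : (⌈x / T⌉₊ : ℝ) ≤ ⌊D / T⌋₊ + 1 := by exact_mod_cast hc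
    nlinarith
  · have hc : ⌈x / T⌉₊ ≤ ⌊D / T⌋₊ := by
      rw [Nat.ceil_le, div_le_iff₀ hT]
      exact not_lt.1 hlt
    have hc' : (⌈x / T⌉₊ : ℝ) ≤ ⌊D / T⌋₊ := by exact_mod_cast hc
    nlinarith

end SuspTaskSystem

theorem theorem5 {n : ℕ} (τ : SuspTaskSystem n) (hRM : τ.IsRMOrdered)
    (M : ℕ) (hM : 0 < M) (k : Fin n)
    (hhp : ∀ i : Fin n, i < k → τ.SchedulableGlobalRM M i)
    (hk : ((τ.C k + τ.S k) / τ.T k + 2) * ∏ j ∈ Finset.Iio k, (τ.U j / (M : ℝ) + 1) ≤ 3) :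
    τ.SchedulableGlobalRM M k := by
  classical
  intro A σ h j
  induction j using Nat.strong_induction_on with
  | _ j ih =>
  intro hj
  by_contra hnf
  have hM' : (0 : ℝ) < M := by exact_mod_cast hM
  have hD := τ.T_pos k
  have hprev : ∀ j' < j, σ.Finished A (k, j') (A.release k j) := fun j' hj' =>
    h.finished_mono (A.release_add_period_le hj' hj)
      (ih j' hj' (lt_trans (by exact_mod_cast hj') hj))
  -- An unfinished job has positive total length.
  have hX : 0 < τ.C k + τ.S k :=
    ((h.progress_nonneg _ _).trans_lt
      (lt_phaseTotal_of_phaseAt_ne_finished (A.phases_nonneg k j hj) hnf)).trans_le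
      (A.phaseTotal_le hj)
  set t : Fin n → ℝ := fun i => ⌊τ.T k / τ.T i⌋₊ * τ.T i with ht
  have ht0 : ∀ i, 0 ≤ t i := fun i => mul_nonneg (Nat.cast_nonneg _) (τ.T_pos i).le
  have htD : ∀ i, t i ≤ τ.T k := fun i => by
    have := Nat.floor_le (div_nonneg hD.le (τ.T_pos i).le)
    rwa [le_div_iff₀ (τ.T_pos i)] at this
  refine absurd hk (not_le.2 (three_lt_of_demand_gt (Finset.Iio k) (fun i => τ.U i / M) t
    (fun i _ => div_nonneg (div_nonneg (τ.C_nonneg i) (τ.T_pos i).le) hM'.le)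
    (fun i _ => ht0 i) hX hD fun x hx => ?_))
  obtain ⟨hx0, hxD⟩ : 0 ≤ x ∧ x ≤ τ.T k := by
    rcases hx with rfl | ⟨i, -, rfl⟩
    exacts [⟨hD.le, le_rfl⟩, ⟨ht0 i, htD i⟩]
  have hlt := h.lt_demand_of_not_finished hM hj (fun i hi => hhp i hi A σ h) hprev hx0
    fun hf => hnf (h.finished_mono (by linarith) hf)
  refine hlt.trans_le ?_
  rw [add_assoc (τ.C k + τ.S k)]
  refine add_le_add le_rfl ?_
  rw [Finset.mul_sum, Finset.sum_filter, ← Finset.sum_add_distrib, Finset.sum_div]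
  refine Finset.sum_le_sum fun i hi => ?_
  have hc := SuspTaskSystem.ceil_add_one_mul_le (τ.C_nonneg i) (τ.T_pos i)
    (hRM i k (Finset.mem_Iio.1 hi).le) hxD
  rw [div_le_iff₀ hM']
  refine hc.trans (le_of_eq ?_)
  simp only [ht, SuspTaskSystem.U]
  split_ifs <;> field_simp <;> ring
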